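/- For real $\varepsilon,\varepsilon'$, $z\in\mathbb C$ and $\tau\in\mathbb C$ with $\operatorname{Im}\tau>0$ let $$\Theta\begin{bmatrix}\varepsilon\\ \varepsilon'\end{bmatrix}(z,\tau)=\sum_{l\in\mathbb Z}\exp\Big(2\pi i\Big\{\tfrac12\big(l+\tfrac{\varepsilon}{2}\big)^2\tau+\big(l+\tfrac{\varepsilon}{2}\big)\big(z+\tfrac{\varepsilon'}{2}\big)\Big\}\Big),$$ and let $$\lambda(\tau)=\frac{\Theta^4\begin{bmatrix}1\\0\end{bmatrix}(0,\tau)}{\Theta^4\begin{bmatrix}0\\0\end{bmatrix}(0,\tau)}$$ be the Legendre modular function; the denominator does not vanish for any $\tau$ with $\operatorname{Im}\tau>0$. For every prime $p$ there is an algebraic relation between $\lambda(\tau)$ and $\lambda(p\tau)$: there is a nonzero polynomial $P\in\mathbb Z[X,Y]$, depending only on $p$, such that $$P(\lambda(\tau),\lambda(p\tau))=0\qquad\text{for all }\tau\in\mathbb C\text{ with }\operatorname{Im}\tau>0.$$ For $p=3$ the following relation holds for all $\tau$ with $\operatorname{Im}\tau>0$. Put $$\sqrt[4]{\lambda(\tau)}:=\frac{\Theta\begin{bmatrix}1\\0\end{bmatrix}(0,\tau)}{\Theta\begin{bmatrix}0\\0\end{bmatrix}(0,\tau)},\qquad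 \sqrt[4]{1-\lambda(\tau)}:=\frac{\Theta\begin{bmatrix}0\\1\end{bmatrix}(0,\tau)}{\Theta\begin{bmatrix}0\\0\end{bmatrix}(0,\tau)}.$$ The fourth powers of these functions are $\lambda(\tau)$ and $1-\lambda(\tau)$ respectively, and $$1=\sqrt[4]{\lambda(\tau)}\,\sqrt[4]{\lambda(3\tau)}+\sqrt[4]{1-\lambda(\tau)}\,\sqrt[4]{1-\lambda(3\tau)}.$$ -/

import Mathlib

/-- The one-dimensional theta function with real characteristic `[ε; ε']`, in the classical
normalization in which the characteristic enters through `ε / 2` and `ε' / 2`: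
the sum over `l ∈ ℤ` of
`exp (2πi ((1/2) (l + ε/2) τ (l + ε/2) + (l + ε/2) (z + ε'/2)))`.
The series converges absolutely when `0 < Im τ`; it is used only for such `τ`. -/
noncomputable def thetaChar (ε ε' : ℝ) (z τ : ℂ) : ℂ :=
  ∑' l : ℤ, Complex.exp (2 * (Real.pi : ℂ) * Complex.I *
    ((1 / 2 : ℂ) * ((l : ℂ) + (ε : ℂ) / 2) * τ * ((l : ℂ) + (ε : ℂ) / 2) +
      ((l : ℂ) + (ε : ℂ) / 2) * (z + (ε' : ℂ) / 2)))

/-- The Legendre modular function `Θ⁴[1;0](0,τ) / Θ⁴[0;0](0,τ)`. -/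
noncomputable def legendreLambda (τ : ℂ) : ℂ :=
  thetaChar 1 0 0 τ ^ 4 / thetaChar 0 0 0 τ ^ 4

/-- The branch `Θ[1;0](0,τ) / Θ[0;0](0,τ)` of the fourth root of the Legendre modular function. -/
noncomputable def fourthRootLambda (τ : ℂ) : ℂ :=
  thetaChar 1 0 0 τ / thetaChar 0 0 0 τ

/-- The branch `Θ[0;1](0,τ) / Θ[0;0](0,τ)` of the fourth root of one minus the Legendre modular
function. -/
noncomputable def fourthRootOneSubLambda (τ : ℂ) : ℂ :=
  thetaChar 0 1 0 τ / thetaChar 0 0 0 τ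

/-!
Write `x = exp (π i τ)` and let `θ₂, θ₃, θ₄` be the theta constants with characteristics `[1; 0]`,
`[0; 0]`, `[0; 1]`, so that `λ = θ₂⁴ / θ₃⁴`.

The identities between theta constants come from rearranging double series. Splitting the pairs
`(m, n)` by the parity of `m + n` expresses `θ₂²`, `θ₃²`, `θ₄²` at `τ` through `θ₂`, `θ₃` at `2τ`,
which gives `θ₃⁴ = θ₂⁴ + θ₄⁴` (`theta3_pow_four`) and `θ₃² θ₄² = θ₄(2τ)⁴`. By the latter and
`θ₄(τ) = θ₃(τ + 1)`, a zero of `θ₃` would produce zeros with arbitrarily large imaginary part, where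
`θ₃` is close to `1`; hence `theta3_ne_zero`. The same splitting, combined with a rotation by a
sixth root of unity for the quadratic form `m² + 3n²`, proves the relation for the prime three
(`theta3_mul_theta3_three_mul`).

The relation between `λ(τ)` and `λ(pτ)` is obtained by counting. The functions `±θ₂⁴, ±θ₃⁴, ±θ₄⁴`
are permuted by `SL(2, ℤ)` in weight two, so `θ₂⁴` and `θ₃⁴` are modular forms for a subgroup of
finite index, and together with their translates under `τ ↦ pτ` they are modular forms for one
arithmetic group `Γ`. The `(n + 1)²` monomials that are homogeneous of degree `n` in the two forms
at `τ` and of degree `n` in the two forms at `pτ` all have weight `4n` and integral expansions in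
`x`. Vanishing to order `M` in `x` imposes `M` linear conditions with integer coefficients, and a
form of weight `4n` for `Γ` that vanishes to an order linear in `n` is zero: its norm to `SL(2, ℤ)`
violates the Sturm bound (`ModularForm.eq_zero_of_isBigO`). For large `n` there are more monomials
than conditions, so a nonzero integral combination vanishes identically
(`ModularForm.exists_int_relation`). Division by the power of `θ₃(τ)⁴ θ₃(pτ)⁴` of exponent `n`
turns this into a polynomial relation between `λ(τ)` and `λ(pτ)`.
-/

open Complex Filter Asymptotics
open UpperHalfPlane hiding I
open scoped Real Polynomial MatrixGroups ModularForm Manifold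

/-! ### Theta constants and their series -/

/-- The exponential `exp (π i s τ)`, with the exponent `s` as the second argument. In particular
`expPi τ 1` is the nome. -/
noncomputable def expPi (τ s : ℂ) : ℂ := cexp (π * I * s * τ)

lemma expPi_add (τ s t : ℂ) : expPi τ (s + t) = expPi τ s * expPi τ t := by
  rw [expPi, expPi, expPi, ← Complex.exp_add]
  ring_nf

lemma expPi_mul_left (c τ s : ℂ) : expPi (c * τ) s = expPi τ (c * s) := by
  rw [expPi, expPi]
  ring_nf

lemma thetaChar_zero_eq_jacobiTheta₂ (ε ε' : ℝ) (τ : ℂ) : thetaChar ε ε' 0 τ =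
    cexp (2 * π * I * (ε / 2) * (ε' / 2)) * expPi τ ((ε / 2) ^ 2) *
      jacobiTheta₂ (ε / 2 * τ + ε' / 2) τ := by
  rw [thetaChar, jacobiTheta₂, ← tsum_mul_left]
  refine tsum_congr fun l ↦ ?_
  rw [jacobiTheta₂_term, expPi, ← Complex.exp_add, ← Complex.exp_add]
  ring_nf

lemma hasSum_thetaChar_zero (ε ε' : ℝ) {τ : ℂ} (hτ : 0 < τ.im) :
    HasSum (fun l : ℤ ↦ cexp (2 * π * I * (l + ε / 2) * (ε' / 2)) * expPi τ ((l + ε / 2) ^ 2))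
      (thetaChar ε ε' 0 τ) := by
  rw [thetaChar_zero_eq_jacobiTheta₂]
  convert! (hasSum_jacobiTheta₂_term (ε / 2 * τ + ε' / 2) hτ).mul_left
    (cexp (2 * π * I * (ε / 2) * (ε' / 2)) * expPi τ ((ε / 2) ^ 2)) using 2 with l
  rw [jacobiTheta₂_term, expPi, expPi, ← Complex.exp_add, ← Complex.exp_add, ← Complex.exp_add]
  ring_nf

/-- The theta constant `θ₂ = Θ[1; 0](0, ·)`. -/
noncomputable def theta2 (τ : ℂ) : ℂ := thetaChar 1 0 0 τ

/-- The theta constant `θ₃ = Θ[0; 0](0, ·)`. -/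
noncomputable def theta3 (τ : ℂ) : ℂ := thetaChar 0 0 0 τ

/-- The theta constant `θ₄ = Θ[0; 1](0, ·)`. -/
noncomputable def theta4 (τ : ℂ) : ℂ := thetaChar 0 1 0 τ

lemma theta2_eq_jacobiTheta₂ (τ : ℂ) :
    theta2 τ = expPi τ (1 / 4) * jacobiTheta₂ (τ / 2) τ := by
  rw [theta2, thetaChar_zero_eq_jacobiTheta₂]
  have h : ((1 : ℝ) / 2 : ℂ) ^ 2 = 1 / 4 := by norm_num
  have h' : ((1 : ℝ) / 2 : ℂ) * τ + (0 : ℝ) / 2 = τ / 2 := by push_cast; ring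
  rw [h, h']
  simp

lemma theta3_eq_jacobiTheta₂ (τ : ℂ) : theta3 τ = jacobiTheta₂ 0 τ := by
  rw [theta3, thetaChar_zero_eq_jacobiTheta₂]
  simp [expPi]

lemma theta4_eq_jacobiTheta₂ (τ : ℂ) : theta4 τ = jacobiTheta₂ (1 / 2) τ := by
  rw [theta4, thetaChar_zero_eq_jacobiTheta₂]
  simp [expPi]

lemma hasSum_theta2 {τ : ℂ} (hτ : 0 < τ.im) :
    HasSum (fun n : ℤ ↦ expPi τ ((n + 1 / 2) ^ 2)) (theta2 τ) := by
  simpa [theta2] using hasSum_thetaChar_zero 1 0 hτ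

lemma hasSum_theta3 {τ : ℂ} (hτ : 0 < τ.im) :
    HasSum (fun n : ℤ ↦ expPi τ (n ^ 2)) (theta3 τ) := by
  simpa [theta3] using hasSum_thetaChar_zero 0 0 hτ

lemma exp_pi_I_mul_intCast (n : ℤ) : cexp (π * I * n) = (-1 : ℂ) ^ n := by
  rw [mul_comm, Complex.exp_int_mul, Complex.exp_pi_mul_I]

lemma hasSum_theta4 {τ : ℂ} (hτ : 0 < τ.im) :
    HasSum (fun n : ℤ ↦ (-1 : ℂ) ^ n * expPi τ (n ^ 2)) (theta4 τ) := by
  convert! hasSum_thetaChar_zero 0 1 hτ using 2 with n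
  rw [← exp_pi_I_mul_intCast]
  congr 2
  · push_cast; ring
  · push_cast; ring

/-! ### Identities between theta constants -/

lemma HasSum.mul_int {f g : ℤ → ℂ} {a b : ℂ} (hf : HasSum f a) (hg : HasSum g b) :
    HasSum (fun z : ℤ × ℤ ↦ f z.1 * g z.2) (a * b) :=
  hf.mul hg (summable_mul_of_summable_norm hf.summable.norm hg.summable.norm)

/-- Pairs of integers with even sum are the `(a + b, a - b)`, those with odd sum the
`(a + b + 1, a - b)`. -/
def intProdParityEquiv : (ℤ × ℤ) ⊕ (ℤ × ℤ) ≃ ℤ × ℤ where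
  toFun := Sum.elim (fun z ↦ (z.1 + z.2, z.1 - z.2)) (fun z ↦ (z.1 + z.2 + 1, z.1 - z.2))
  invFun z := if (z.1 + z.2) % 2 = 0 then .inl ((z.1 + z.2) / 2, (z.1 - z.2) / 2)
    else .inr ((z.1 + z.2) / 2, (z.1 - z.2) / 2)
  left_inv := by
    rintro (⟨a, b⟩ | ⟨a, b⟩)
    · have h : (a + b + (a - b)) % 2 = 0 := by omega
      simp only [Sum.elim_inl, h, if_true, Sum.inl.injEq, Prod.mk.injEq]
      omega
    · have h : ¬ (a + b + 1 + (a - b)) % 2 = 0 := by omega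
      simp only [Sum.elim_inr, h, if_false, Sum.inr.injEq, Prod.mk.injEq]
      omega
  right_inv := by
    rintro ⟨m, n⟩
    by_cases h : (m + n) % 2 = 0
    · simp only [h, if_true, Sum.elim_inl, Prod.mk.injEq]
      omega
    · simp only [h, if_false, Sum.elim_inr, Prod.mk.injEq]
      omega

/-- Splitting a sum over `ℤ × ℤ` by the parity of the sum of the indices. -/
lemma HasSum.eq_even_add_odd {f : ℤ × ℤ → ℂ} {s : ℂ} (hf : HasSum f s) :
    ∃ u v, HasSum (fun z : ℤ × ℤ ↦ f (z.1 + z.2, z.1 - z.2)) u ∧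
      HasSum (fun z : ℤ × ℤ ↦ f (z.1 + z.2 + 1, z.1 - z.2)) v ∧ s = u + v := by
  have h := intProdParityEquiv.hasSum_iff.mpr hf
  have hu := (h.summable.comp_injective Sum.inl_injective).hasSum
  have hv := (h.summable.comp_injective Sum.inr_injective).hasSum
  exact ⟨_, _, hu, hv, h.unique (hu.sum hv)⟩

section Identities

variable {τ : ℂ}

lemma two_mul_im_pos (hτ : 0 < τ.im) : 0 < (2 * τ).im := by simpa using hτ

lemma three_mul_im_pos (hτ : 0 < τ.im) : 0 < (3 * τ).im := by simpa using hτ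

lemma theta3_sq (hτ : 0 < τ.im) : theta3 τ ^ 2 = theta3 (2 * τ) ^ 2 + theta2 (2 * τ) ^ 2 := by
  have h2 := two_mul_im_pos hτ
  obtain ⟨u, v, hu, hv, h⟩ := ((hasSum_theta3 hτ).mul_int (hasSum_theta3 hτ)).eq_even_add_odd
  have h3 := (hasSum_theta3 h2).mul_int (hasSum_theta3 h2)
  have h2 := (hasSum_theta2 h2).mul_int (hasSum_theta2 h2)
  simp only [expPi_mul_left, ← expPi_add] at *
  rw [sq, h, sq, sq]
  congr 1
  · refine hu.unique ?_
    convert! h3 using 3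
    push_cast; ring
  · refine hv.unique ?_
    convert! h2 using 3
    push_cast; ring

lemma theta4_sq (hτ : 0 < τ.im) : theta4 τ ^ 2 = theta3 (2 * τ) ^ 2 - theta2 (2 * τ) ^ 2 := by
  have h2 := two_mul_im_pos hτ
  obtain ⟨u, v, hu, hv, h⟩ := ((hasSum_theta4 hτ).mul_int (hasSum_theta4 hτ)).eq_even_add_odd
  have h3 := (hasSum_theta3 h2).mul_int (hasSum_theta3 h2)
  have h2 := ((hasSum_theta2 h2).mul_int (hasSum_theta2 h2)).neg
  have sgn (m n : ℤ) (x y : ℂ) : (-1 : ℂ) ^ m * x * ((-1) ^ n * y) = (-1) ^ (m + n) * (x * y) := by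
    rw [zpow_add₀ (by norm_num)]; ring
  simp only [expPi_mul_left, sgn, ← expPi_add] at *
  rw [sq, h, sq, sq, sub_eq_add_neg]
  congr 1
  · refine hu.unique ?_
    convert! h3 using 2 with z
    rw [Even.neg_one_zpow ⟨z.1, by ring⟩, one_mul]
    congr 1
    push_cast; ring
  · refine hv.unique ?_
    convert! h2 using 2 with z
    rw [Odd.neg_one_zpow ⟨z.1, by ring⟩, neg_one_mul]
    congr 2
    push_cast; ring

lemma theta2_sq (hτ : 0 < τ.im) : theta2 τ ^ 2 = 2 * (theta2 (2 * τ) * theta3 (2 * τ)) := by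
  have h2 := two_mul_im_pos hτ
  obtain ⟨u, v, hu, hv, h⟩ := ((hasSum_theta2 hτ).mul_int (hasSum_theta2 hτ)).eq_even_add_odd
  have h23 := (hasSum_theta2 h2).mul_int (hasSum_theta3 h2)
  have h32 := (hasSum_theta3 h2).mul_int (hasSum_theta2 h2)
  rw [← ((Equiv.addRight (1 : ℤ)).prodCongr (Equiv.refl ℤ)).hasSum_iff] at h32
  simp only [expPi_mul_left, ← expPi_add, Function.comp_def] at *
  rw [sq, h, two_mul]
  congr 1
  · refine hu.unique ?_
    convert! h23 using 3
    push_cast; ring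
  · rw [mul_comm]
    refine hv.unique ?_
    convert! h32 using 3
    simp only [Equiv.prodCongr_apply, Prod.map, Equiv.coe_addRight, Equiv.refl_apply]
    push_cast; ring

/-- Jacobi's quartic identity. -/
lemma theta3_pow_four (hτ : 0 < τ.im) : theta3 τ ^ 4 = theta2 τ ^ 4 + theta4 τ ^ 4 := by
  linear_combination (theta3 τ ^ 2 + theta3 (2 * τ) ^ 2 + theta2 (2 * τ) ^ 2) * theta3_sq hτ
    - (theta4 τ ^ 2 + theta3 (2 * τ) ^ 2 - theta2 (2 * τ) ^ 2) * theta4_sq hτ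
    - (theta2 τ ^ 2 + 2 * (theta2 (2 * τ) * theta3 (2 * τ))) * theta2_sq hτ

lemma theta3_sq_mul_theta4_sq (hτ : 0 < τ.im) :
    theta3 τ ^ 2 * theta4 τ ^ 2 = theta4 (2 * τ) ^ 4 := by
  rw [theta3_sq hτ, theta4_sq hτ]
  linear_combination theta3_pow_four (two_mul_im_pos hτ)

/-- The cubic modular equation of Legendre and Jacobi.  In the difference
`θ₃(τ) θ₃(3τ) - θ₄(τ) θ₄(3τ)` only the terms of `x² + 3y²` with `x + y` odd survive, twice.
Up to conjugation, multiplication by a sixth root of unity of `ℚ(√-3)` maps each parity class of the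
half-integral points occurring in `θ₂(τ) θ₂(3τ)` onto the points surviving on the left. -/
lemma theta3_mul_theta3_three_mul (hτ : 0 < τ.im) :
    theta3 τ * theta3 (3 * τ) = theta2 τ * theta2 (3 * τ) + theta4 τ * theta4 (3 * τ) := by
  have h3 := three_mul_im_pos hτ
  obtain ⟨u, v, hu, hv, h⟩ := ((hasSum_theta3 hτ).mul_int (hasSum_theta3 h3)).eq_even_add_odd
  obtain ⟨u', v', hu', hv', h'⟩ := ((hasSum_theta4 hτ).mul_int (hasSum_theta4 h3)).eq_even_add_odd
  obtain ⟨a, b, ha, hb, h''⟩ := ((hasSum_theta2 hτ).mul_int (hasSum_theta2 h3)).eq_even_add_odd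
  have sgn (m n : ℤ) (x y : ℂ) : (-1 : ℂ) ^ m * x * ((-1) ^ n * y) = (-1) ^ (m + n) * (x * y) := by
    rw [zpow_add₀ (by norm_num)]; ring
  simp only [expPi_mul_left, sgn, ← expPi_add] at *
  have e1 : u' = u := by
    refine hu'.unique ?_
    convert! hu using 2 with z
    rw [Even.neg_one_zpow ⟨z.1, by ring⟩, one_mul]
  have e2 : v' = -v := by
    refine hv'.unique ?_
    convert! hv.neg using 2 with z
    rw [Odd.neg_one_zpow ⟨z.1, by ring⟩, neg_one_mul]
  have e3 : a = v := by
    let e : ℤ × ℤ ≃ ℤ × ℤ := ⟨fun z ↦ (z.1, z.1 - z.2), fun z ↦ (z.1, z.1 - z.2),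
      fun z ↦ by simp, fun z ↦ by simp⟩
    refine ha.unique ?_
    convert! e.hasSum_iff.mpr hv using 3
    simp only [e, Function.comp_apply, Equiv.coe_fn_mk]
    push_cast
    ring_nf
  have e4 : b = v := by
    let e : ℤ × ℤ ≃ ℤ × ℤ := ⟨fun z ↦ (z.2, z.2 - z.1 - 1), fun z ↦ (z.1 - z.2 - 1, z.1),
      fun z ↦ Prod.ext (by dsimp only; ring) rfl, fun z ↦ Prod.ext rfl (by dsimp only; ring)⟩
    refine hb.unique ?_
    convert! e.hasSum_iff.mpr hv using 3
    simp only [e, Function.comp_apply, Equiv.coe_fn_mk]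
    push_cast
    ring_nf
  rw [h, h', h'', e1, e2, e3, e4]
  ring

end Identities

/-! ### Behaviour under `τ ↦ τ + 1` and `τ ↦ -1 / τ` -/

section Transformations

lemma theta2_add_one_pow_four {τ : ℂ} (hτ : 0 < τ.im) : theta2 (τ + 1) ^ 4 = -theta2 τ ^ 4 := by
  have h1 : 0 < (τ + 1).im := by simpa using hτ
  have h : theta2 (τ + 1) = cexp (π * I / 4) * theta2 τ := by
    refine (hasSum_theta2 h1).unique ?_
    convert! (hasSum_theta2 hτ).mul_left (cexp (π * I / 4)) using 2 with n
    obtain ⟨k, hk⟩ := Int.even_mul_succ_self n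
    have hk' : (n * (n + 1) : ℂ) = k + k := by exact_mod_cast congrArg (Int.cast (R := ℂ)) hk
    rw [expPi, expPi, ← Complex.exp_add, Complex.exp_eq_exp_iff_exists_int]
    exact ⟨k, by linear_combination π * I * hk'⟩
  rw [h, mul_pow, ← Complex.exp_nat_mul]
  have : ((4 : ℕ) : ℂ) * (π * I / 4) = π * I := by push_cast; ring
  rw [this, Complex.exp_pi_mul_I, neg_one_mul]

lemma theta3_add_one {τ : ℂ} (hτ : 0 < τ.im) : theta3 (τ + 1) = theta4 τ := by
  have h1 : 0 < (τ + 1).im := by simpa using hτ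
  refine (hasSum_theta3 h1).unique ?_
  convert! hasSum_theta4 hτ using 2 with n
  obtain ⟨k, hk⟩ := Int.even_mul_pred_self n
  have hk' : (n * (n - 1) : ℂ) = k + k := by exact_mod_cast congrArg (Int.cast (R := ℂ)) hk
  rw [← exp_pi_I_mul_intCast, expPi, expPi, ← Complex.exp_add, Complex.exp_eq_exp_iff_exists_int]
  exact ⟨k, by linear_combination π * I * hk'⟩

lemma theta4_add_one {τ : ℂ} (hτ : 0 < τ.im) : theta4 (τ + 1) = theta3 τ := by
  rw [← theta3_add_one (by simpa using hτ), theta3_eq_jacobiTheta₂, theta3_eq_jacobiTheta₂,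
    ← jacobiTheta₂_add_right 0 τ]
  ring_nf

lemma sqrt_neg_I_mul_pow_four (τ : ℂ) : ((-I * τ) ^ (1 / 2 : ℂ)) ^ 4 = -τ ^ 2 := by
  rw [← Complex.cpow_nat_mul]
  norm_num [mul_pow]

lemma theta3_neg_one_div_pow_four {τ : ℂ} (hτ : 0 < τ.im) :
    theta3 (-1 / τ) ^ 4 = -τ ^ 2 * theta3 τ ^ 4 := by
  have h0 : τ ≠ 0 := by rintro rfl; simp at hτ
  rw [theta3_eq_jacobiTheta₂ τ, jacobiTheta₂_functional_equation 0 τ, mul_pow, mul_pow, div_pow,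
    sqrt_neg_I_mul_pow_four, theta3_eq_jacobiTheta₂]
  simp
  field_simp

lemma theta2_neg_one_div_pow_four {τ : ℂ} (hτ : 0 < τ.im) :
    theta2 (-1 / τ) ^ 4 = -τ ^ 2 * theta4 τ ^ 4 := by
  have h0 : τ ≠ 0 := by rintro rfl; simp at hτ
  have h1 : expPi (-1 / τ) (1 / 4) = cexp (-π * I * (1 / 2) ^ 2 / τ) := by
    rw [expPi]; ring_nf
  have h2 : jacobiTheta₂ (-1 / τ / 2) (-1 / τ) = jacobiTheta₂ (1 / 2 / τ) (-1 / τ) := by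
    rw [← jacobiTheta₂_neg_left]; ring_nf
  rw [theta4_eq_jacobiTheta₂ τ, jacobiTheta₂_functional_equation (1 / 2) τ, mul_pow, mul_pow,
    div_pow, sqrt_neg_I_mul_pow_four, theta2_eq_jacobiTheta₂, h1, h2, mul_pow]
  field_simp

lemma neg_one_div_im_pos {τ : ℂ} (hτ : 0 < τ.im) : 0 < (-1 / τ).im := by
  have := (UpperHalfPlane.im_inv_neg_coe_pos ⟨τ, hτ⟩)
  rwa [neg_div, one_div, ← inv_neg]

lemma theta4_neg_one_div_pow_four {τ : ℂ} (hτ : 0 < τ.im) :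
    theta4 (-1 / τ) ^ 4 = -τ ^ 2 * theta2 τ ^ 4 := by
  have h0 : τ ≠ 0 := by rintro rfl; simp at hτ
  have h := theta2_neg_one_div_pow_four (neg_one_div_im_pos hτ)
  have : -1 / (-1 / τ) = τ := by field_simp
  rw [this] at h
  rw [h]
  field_simp

end Transformations

/-! ### Nonvanishing of `θ₃` -/

/-- A zero of `θ₃` at `τ` gives one at `2τ + 1`, whose imaginary part is twice as large, but
`θ₃` tends to `1` as the imaginary part grows. -/
lemma theta3_ne_zero {τ : ℂ} (hτ : 0 < τ.im) : theta3 τ ≠ 0 := by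
  intro h0
  have key (n : ℕ) : ∃ w : ℂ, w.im = 2 ^ n * τ.im ∧ theta3 w = 0 := by
    induction n with
    | zero => exact ⟨τ, by simp, h0⟩
    | succ n ih =>
      obtain ⟨w, hw, hw0⟩ := ih
      have hwpos : 0 < w.im := by rw [hw]; positivity
      refine ⟨2 * w + 1, by simp [hw]; ring, ?_⟩
      rw [theta3_add_one (two_mul_im_pos hwpos)]
      have := theta3_sq_mul_theta4_sq hwpos
      rw [hw0] at this
      exact pow_eq_zero_iff (n := 4) (by norm_num) |>.mp (by rw [← this]; ring)
  have hO := isBigO_at_im_infty_jacobiTheta_sub_one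
  have hlim : Tendsto (fun w : ℂ ↦ jacobiTheta w - 1) (comap Complex.im atTop) (nhds 0) := by
    refine hO.trans_tendsto ?_
    refine Real.tendsto_exp_atBot.comp ?_
    exact (tendsto_comap (f := Complex.im) (x := atTop)).const_mul_atTop_of_neg
      (by simp [Real.pi_pos])
  choose w hw hw0 using key
  have hwt : Tendsto w atTop (comap Complex.im atTop) := by
    rw [tendsto_comap_iff]
    simp only [Function.comp_def, hw]
    exact (tendsto_pow_atTop_atTop_of_one_lt (by norm_num)).atTop_mul_const hτ
  have := hlim.comp hwt
  simp only [Function.comp_def, jacobiTheta_eq_jacobiTheta₂, ← theta3_eq_jacobiTheta₂, hw0] at this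
  simpa using tendsto_nhds_unique this tendsto_const_nhds

/-! ### Integral expansions at infinity -/

section Expansions

/-- A function on the upper half plane has an integral expansion if, to every order, it is
approximated at `i∞` by an integer polynomial in `exp (π i τ)`. -/
def HasIntExpansion (f : ℍ → ℂ) : Prop :=
  ∀ M : ℕ, ∃ Q : ℤ[X], (fun τ : ℍ ↦ f τ - Q.aeval (expPi τ 1)) =O[atImInfty]
    fun τ : ℍ ↦ expPi τ 1 ^ M

lemma norm_expPi_one (τ : ℂ) : ‖expPi τ 1‖ = Real.exp (-π * τ.im) := by
  rw [expPi, Complex.norm_exp]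
  simp

lemma norm_expPi_one_lt_one (τ : ℍ) : ‖expPi τ 1‖ < 1 := by
  rw [norm_expPi_one, Real.exp_lt_one_iff]
  have := τ.im_pos
  have := Real.pi_pos
  simp only [coe_im]
  nlinarith

lemma isBigO_expPi_one_pow {M N : ℕ} (h : N ≤ M) :
    (fun τ : ℍ ↦ expPi τ 1 ^ M) =O[atImInfty] fun τ : ℍ ↦ expPi τ 1 ^ N := by
  refine .of_bound 1 (.of_forall fun τ ↦ ?_)
  rw [one_mul, norm_pow, norm_pow]
  exact pow_le_pow_of_le_one (norm_nonneg _) (norm_expPi_one_lt_one τ).le h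

lemma isBigO_aeval_expPi_one (Q : ℤ[X]) :
    (fun τ : ℍ ↦ Q.aeval (expPi τ 1)) =O[atImInfty] fun _ ↦ (1 : ℂ) := by
  simp only [Polynomial.aeval_eq_sum_range]
  refine IsBigO.fun_sum fun i _ ↦ ?_
  refine IsBigO.const_smul_left ?_ _
  simpa using isBigO_expPi_one_pow (Nat.zero_le i)

namespace HasIntExpansion

variable {f g : ℍ → ℂ}

lemma isBigO_one (hf : HasIntExpansion f) : f =O[atImInfty] fun _ ↦ (1 : ℂ) := by
  obtain ⟨Q, hQ⟩ := hf 0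
  simp only [pow_zero] at hQ
  simpa using hQ.add (isBigO_aeval_expPi_one Q)

lemma isBoundedAtImInfty (hf : HasIntExpansion f) : IsBoundedAtImInfty f :=
  hf.isBigO_one.trans (isBigO_const_const _ one_ne_zero _)

lemma mul (hf : HasIntExpansion f) (hg : HasIntExpansion g) : HasIntExpansion (f * g) := by
  intro M
  obtain ⟨Q, hQ⟩ := hf M
  obtain ⟨R, hR⟩ := hg M
  refine ⟨Q * R, ?_⟩
  have h := (hf.isBigO_one.mul hR).add ((isBigO_aeval_expPi_one R).mul hQ)
  simp only [one_mul] at h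
  refine h.congr_left fun τ ↦ ?_
  simp only [Pi.mul_apply, map_mul]
  ring

lemma aeval (Q : ℤ[X]) : HasIntExpansion fun τ ↦ Q.aeval (expPi τ 1) :=
  fun M ↦ ⟨Q, by simpa using isBigO_zero _ _⟩

lemma pow (hf : HasIntExpansion f) (n : ℕ) : HasIntExpansion (f ^ n) := by
  induction n with
  | zero => simpa [Pi.one_def] using aeval 1
  | succ n ih => simpa [pow_succ] using ih.mul hf

/-- The substitution `τ ↦ pτ` replaces `exp (π i τ)` by its `p`-th power. -/
lemma comp_natCast_mul (hf : HasIntExpansion f) {p : ℕ} (hp : 0 < p) {σ : ℍ → ℍ}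
    (hσ : ∀ τ, (σ τ : ℂ) = p * τ) : HasIntExpansion fun τ ↦ f (σ τ) := by
  have hx (τ : ℍ) : expPi (σ τ) 1 = expPi τ 1 ^ p := by
    rw [hσ, expPi, expPi, ← Complex.exp_nat_mul]
    ring_nf
  have him (τ : ℍ) : (σ τ).im = p * τ.im := by
    have := congrArg Complex.im (hσ τ)
    simpa using this
  have ht : Tendsto σ atImInfty atImInfty := by
    rw [atImInfty, tendsto_comap_iff]
    simp only [Function.comp_def, him]
    exact tendsto_comap.const_mul_atTop (by exact_mod_cast hp)
  intro M
  obtain ⟨Q, hQ⟩ := hf M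
  refine ⟨Q.comp (Polynomial.X ^ p), ?_⟩
  refine ((hQ.comp_tendsto ht).trans ?_).congr_left fun τ ↦ ?_
  · simp only [Function.comp_def, hx, ← pow_mul]
    exact isBigO_expPi_one_pow (Nat.le_mul_of_pos_left M hp)
  · simp [hx, Polynomial.aeval_comp]

/-- The sum of a family of powers of `exp (π i τ)` has an integral expansion: only finitely many
exponents are below a given order, and the remaining terms are dominated by their values at `i`. -/
lemma of_hasSum {ι : Type*} {e : ι → ℕ} (hf : ∀ τ : ℍ, HasSum (fun i ↦ expPi τ 1 ^ e i) (f τ)) :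
    HasIntExpansion f := by
  intro M
  set r : ℝ := ‖expPi UpperHalfPlane.I 1‖ with hr
  have hr0 : 0 < r := norm_pos_iff.mpr (Complex.exp_ne_zero _)
  have hsum : Summable fun i ↦ r ^ e i := by
    simpa only [norm_pow] using (hf UpperHalfPlane.I).summable.norm
  have hfin : {i | e i < M}.Finite := by
    have h := hsum.tendsto_cofinite_zero.eventually_lt_const (pow_pos hr0 M)
    refine Set.Finite.subset h fun i hi ↦ ?_
    simp only [Set.mem_compl_iff, Set.mem_ofPred_eq, not_lt]
    exact pow_le_pow_of_le_one hr0.le (norm_expPi_one_lt_one UpperHalfPlane.I).le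
      (le_of_lt hi)
  refine ⟨∑ i ∈ hfin.toFinset, Polynomial.X ^ e i, ?_⟩
  refine .of_bound (∑' i, r ^ e i / r ^ M) ?_
  have hev : ∀ᶠ τ : ℍ in atImInfty, 1 ≤ τ.im := tendsto_comap.eventually_ge_atTop 1
  filter_upwards [hev] with τ hτ
  have hx : ‖expPi τ 1‖ ≤ r := by
    rw [hr, norm_expPi_one, norm_expPi_one, Real.exp_le_exp]
    simp only [coe_im, UpperHalfPlane.I_im]
    nlinarith [Real.pi_pos]
  have hS : HasSum (fun i ↦ if e i < M then expPi τ 1 ^ e i else 0)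
      (∑ i ∈ hfin.toFinset, expPi τ 1 ^ e i) := by
    have : ∑ i ∈ hfin.toFinset, expPi τ 1 ^ e i =
        ∑ i ∈ hfin.toFinset, if e i < M then expPi τ 1 ^ e i else 0 :=
      Finset.sum_congr rfl fun i hi ↦ by
        rw [if_pos (by simpa using hi)]
    rw [this]
    exact hasSum_sum_of_ne_finset_zero fun i hi ↦ if_neg (by simpa using hi)
  have hd := (hf τ).sub hS
  have hbound (i : ι) : ‖expPi τ 1 ^ e i - if e i < M then expPi τ 1 ^ e i else 0‖ ≤
      r ^ e i / r ^ M * ‖expPi τ 1‖ ^ M := by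
    split_ifs with h
    · rw [sub_self, norm_zero]; positivity
    · obtain ⟨k, hk⟩ := Nat.exists_eq_add_of_le (not_lt.mp h)
      rw [sub_zero, norm_pow, hk, pow_add, pow_add, mul_div_cancel_left₀ _ (pow_pos hr0 M).ne',
        mul_comm]
      gcongr
  have hb := tsum_of_norm_bounded ((hsum.div_const (r ^ M)).hasSum.mul_right _) hbound
  rw [hd.tsum_eq] at hb
  simpa using hb

end HasIntExpansion

lemma hasIntExpansion_theta3 : HasIntExpansion fun τ ↦ theta3 τ := by
  refine .of_hasSum (e := fun n : ℤ ↦ n.natAbs ^ 2) fun τ ↦ ?_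
  convert! hasSum_theta3 τ.im_pos using 2 with n
  have : ((n.natAbs : ℂ)) ^ 2 = (n : ℂ) ^ 2 := by
    rw [← Int.cast_natCast, ← Int.cast_pow, Int.natAbs_sq, Int.cast_pow]
  rw [expPi, expPi, ← Complex.exp_nat_mul]
  push_cast
  rw [this]
  ring_nf

/-- `θ₂⁴` is `x` times the fourth power of `∑ x ^ (n (n + 1))`, where `x = exp (π i τ)`. -/
lemma hasIntExpansion_theta2_pow_four : HasIntExpansion fun τ ↦ theta2 τ ^ 4 := by
  have h : HasIntExpansion fun τ ↦ expPi τ (-1 / 4) * theta2 τ := by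
    refine .of_hasSum (e := fun n : ℤ ↦ (n * (n + 1)).toNat) fun τ ↦ ?_
    convert! (hasSum_theta2 τ.im_pos).mul_left (expPi τ (-1 / 4)) using 2 with n
    have hn : 0 ≤ n * (n + 1) := by
      rcases le_or_gt 0 n with h | h
      · positivity
      · exact mul_nonneg_of_nonpos_of_nonpos h.le (by omega)
    have : (((n * (n + 1)).toNat : ℕ) : ℂ) = n * (n + 1) := by
      exact_mod_cast congrArg (Int.cast (R := ℂ)) (Int.toNat_of_nonneg hn)
    rw [expPi, expPi, expPi, ← Complex.exp_nat_mul, ← Complex.exp_add, this]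
    ring_nf
  convert! (HasIntExpansion.aeval Polynomial.X).mul (h.pow 4) using 1
  funext τ
  have : expPi τ 1 * expPi τ (-1 / 4) ^ 4 = 1 := by
    rw [expPi, expPi, ← Complex.exp_nat_mul, ← Complex.exp_add, ← Complex.exp_zero]
    push_cast
    ring_nf
  simp only [Pi.mul_apply, Pi.pow_apply, Polynomial.aeval_X, mul_pow]
  linear_combination (-theta2 τ ^ 4) * this

lemma hasIntExpansion_theta3_pow_four : HasIntExpansion fun τ ↦ theta3 τ ^ 4 :=
  hasIntExpansion_theta3.pow 4

end Expansions

/-! ### The fourth powers of the theta constants as modular forms -/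

section Modularity

/-- The six functions `±θ₂⁴, ±θ₃⁴, ±θ₄⁴` on the upper half plane. -/
def thetaOrbit : Set (ℍ → ℂ) :=
  {fun τ : ℍ ↦ theta2 τ ^ 4, fun τ : ℍ ↦ -theta2 τ ^ 4, fun τ : ℍ ↦ theta3 τ ^ 4,
    fun τ : ℍ ↦ -theta3 τ ^ 4, fun τ : ℍ ↦ theta4 τ ^ 4, fun τ : ℍ ↦ -theta4 τ ^ 4}

lemma finite_thetaOrbit : thetaOrbit.Finite := by
  simp [thetaOrbit]

lemma slash_T_apply (f : ℍ → ℂ) (τ : ℍ) : (f ∣[(2 : ℤ)] ModularGroup.T) τ = f ((1 : ℝ) +ᵥ τ) := by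
  rw [ModularForm.SL_slash_apply, modular_T_smul, ModularGroup.denom_apply]
  simp [ModularGroup.T]

lemma slash_S_apply (f : ℍ → ℂ) (τ : ℍ) :
    (f ∣[(2 : ℤ)] ModularGroup.S) τ = f (mk (-τ)⁻¹ τ.im_inv_neg_coe_pos) * (τ : ℂ) ^ (-2 : ℤ) := by
  rw [ModularForm.SL_slash_apply, modular_S_smul, ModularGroup.denom_S]

lemma slash_T_mem_thetaOrbit {f : ℍ → ℂ} (hf : f ∈ thetaOrbit) :
    f ∣[(2 : ℤ)] ModularGroup.T ∈ thetaOrbit := by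
  have h2 : ∀ τ : ℍ, theta2 (1 + τ) ^ 4 = -theta2 τ ^ 4 := fun τ ↦ by
    rw [add_comm, theta2_add_one_pow_four τ.im_pos]
  have h3 : ∀ τ : ℍ, theta3 (1 + τ) = theta4 τ := fun τ ↦ by
    rw [add_comm, theta3_add_one τ.im_pos]
  have h4 : ∀ τ : ℍ, theta4 (1 + τ) = theta3 τ := fun τ ↦ by
    rw [add_comm, theta4_add_one τ.im_pos]
  have e (f : ℍ → ℂ) : f ∣[(2 : ℤ)] ModularGroup.T = fun τ ↦ f ((1 : ℝ) +ᵥ τ) :=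
    funext (slash_T_apply f)
  rcases hf with rfl | rfl | rfl | rfl | rfl | rfl <;>
    simp [e, h2, h3, h4, thetaOrbit]

lemma slash_S_mem_thetaOrbit {f : ℍ → ℂ} (hf : f ∈ thetaOrbit) :
    f ∣[(2 : ℤ)] ModularGroup.S ∈ thetaOrbit := by
  have e (τ : ℍ) : (-(τ : ℂ))⁻¹ = -1 / τ := by rw [neg_div, one_div, inv_neg]
  have cancel (τ : ℍ) (x : ℂ) : -(τ : ℂ) ^ 2 * x * (τ : ℂ) ^ (-2 : ℤ) = -x := by
    have := τ.ne_zero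
    rw [zpow_neg, zpow_ofNat]
    field_simp
  have h2 (τ : ℍ) : theta2 (-(τ : ℂ))⁻¹ ^ 4 * (τ : ℂ) ^ (-2 : ℤ) = -theta4 τ ^ 4 := by
    rw [e, theta2_neg_one_div_pow_four τ.im_pos, cancel]
  have h3 (τ : ℍ) : theta3 (-(τ : ℂ))⁻¹ ^ 4 * (τ : ℂ) ^ (-2 : ℤ) = -theta3 τ ^ 4 := by
    rw [e, theta3_neg_one_div_pow_four τ.im_pos, cancel]
  have h4 (τ : ℍ) : theta4 (-(τ : ℂ))⁻¹ ^ 4 * (τ : ℂ) ^ (-2 : ℤ) = -theta2 τ ^ 4 := by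
    rw [e, theta4_neg_one_div_pow_four τ.im_pos, cancel]
  have e' (f : ℍ → ℂ) : f ∣[(2 : ℤ)] ModularGroup.S =
      fun τ : ℍ ↦ f (mk (-τ)⁻¹ τ.im_inv_neg_coe_pos) * (τ : ℂ) ^ (-2 : ℤ) :=
    funext (slash_S_apply f)
  rcases hf with rfl | rfl | rfl | rfl | rfl | rfl <;>
    simp only [e', neg_mul, h2, h3, h4, neg_neg] <;> simp [thetaOrbit]

lemma slash_mem_thetaOrbit (γ : SL(2, ℤ)) :
    ∀ f ∈ thetaOrbit, f ∣[(2 : ℤ)] γ ∈ thetaOrbit := by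
  have hγ : γ ∈ Subgroup.closure {ModularGroup.S, ModularGroup.T} := by
    rw [SpecialLinearGroup.SL2Z_generators]; trivial
  induction hγ using Subgroup.closure_induction with
  | mem x hx =>
    rcases hx with rfl | rfl
    · exact fun f ↦ slash_S_mem_thetaOrbit
    · exact fun f ↦ slash_T_mem_thetaOrbit
  | one => simp
  | mul x y _ _ hx hy =>
    intro f hf
    rw [SlashAction.slash_mul]
    exact hy _ (hx f hf)
  | inv x _ hx =>
    -- A self-map of a finite set given by an invertible action is bijective.
    have hinj : Set.InjOn (fun f : ℍ → ℂ ↦ f ∣[(2 : ℤ)] x) thetaOrbit := fun f _ g _ h ↦ by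
      have := congrArg (fun f : ℍ → ℂ ↦ f ∣[(2 : ℤ)] x⁻¹) h
      simpa [← SlashAction.slash_mul] using this
    have hsurj := ((finite_thetaOrbit.injOn_iff_bijOn_of_mapsTo hx).mp hinj).surjOn
    intro f hf
    obtain ⟨g, hg, rfl⟩ := hsurj hf
    simpa [← SlashAction.slash_mul] using hg

/-- The subgroup of `SL(2, ℤ)` fixing `θ₂⁴`, `θ₃⁴` and `θ₄⁴` under the slash action of weight
two. -/
def thetaStabilizer : Subgroup SL(2, ℤ) where
  carrier := {γ | ∀ f ∈ thetaOrbit, f ∣[(2 : ℤ)] γ = f}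
  mul_mem' {a b} ha hb f hf := by rw [SlashAction.slash_mul, ha f hf, hb f hf]
  one_mem' f _ := SlashAction.slash_one _ f
  inv_mem' {a} ha f hf := by
    conv_lhs => rw [← ha f hf]
    rw [← SlashAction.slash_mul, mul_inv_cancel, SlashAction.slash_one]

instance : thetaStabilizer.FiniteIndex := by
  have : Finite thetaOrbit := finite_thetaOrbit
  have : Finite (SL(2, ℤ) ⧸ thetaStabilizer) := by
    refine Finite.of_injective (β := thetaOrbit → thetaOrbit)
      (fun q f ↦ ⟨f.1 ∣[(2 : ℤ)] q.out⁻¹, slash_mem_thetaOrbit _ _ f.2⟩) fun q q' h ↦ ?_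
    rw [← QuotientGroup.out_eq' q, ← QuotientGroup.out_eq' q', QuotientGroup.eq]
    intro f hf
    have := congrArg Subtype.val (congrFun h ⟨f, hf⟩)
    simp only at this
    rw [SlashAction.slash_mul, this, ← SlashAction.slash_mul, inv_mul_cancel,
      SlashAction.slash_one]
  exact Subgroup.finiteIndex_of_finite_quotient

lemma mdifferentiable_theta2_pow_four : MDiff (fun τ : ℍ ↦ theta2 τ ^ 4) := by
  rw [UpperHalfPlane.mdifferentiable_iff]
  have h : DifferentiableOn ℂ (fun z ↦ theta2 z ^ 4) {z | 0 < z.im} := by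
    intro z hz
    refine (DifferentiableAt.pow ?_ 4).differentiableWithinAt
    simp only [funext theta2_eq_jacobiTheta₂]
    refine DifferentiableAt.mul (by unfold expPi; fun_prop) ?_
    have h1 := (hasFDerivAt_jacobiTheta₂ (z / 2) hz).differentiableAt
    exact h1.comp (f := fun z : ℂ ↦ (z / 2, z)) z (by fun_prop)
  refine h.congr fun z hz ↦ ?_
  simp [ofComplex_apply_of_im_pos hz]

lemma mdifferentiable_theta3_pow_four : MDiff (fun τ : ℍ ↦ theta3 τ ^ 4) := by
  rw [UpperHalfPlane.mdifferentiable_iff]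
  have h : DifferentiableOn ℂ (fun z ↦ theta3 z ^ 4) {z | 0 < z.im} := by
    intro z hz
    refine (DifferentiableAt.pow ?_ 4).differentiableWithinAt
    simp only [funext theta3_eq_jacobiTheta₂]
    exact differentiableAt_jacobiTheta₂_snd 0 hz
  refine h.congr fun z hz ↦ ?_
  simp [ofComplex_apply_of_im_pos hz]

lemma isBoundedAtImInfty_of_mem_thetaOrbit {f : ℍ → ℂ} (hf : f ∈ thetaOrbit) :
    IsBoundedAtImInfty f := by
  have h2 := hasIntExpansion_theta2_pow_four.isBoundedAtImInfty
  have h3 := hasIntExpansion_theta3_pow_four.isBoundedAtImInfty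
  have h4 : IsBoundedAtImInfty fun τ ↦ theta4 τ ^ 4 := by
    refine (IsBigO.sub h3 h2).congr_left fun τ ↦ ?_
    rw [theta3_pow_four τ.im_pos, add_sub_cancel_left]
  rcases hf with rfl | rfl | rfl | rfl | rfl | rfl
  exacts [h2, h2.neg_left, h3, h3.neg_left, h4, h4.neg_left]

/-- The holomorphic elements of `thetaOrbit` are modular forms of weight two. -/
noncomputable def modularFormOfMemThetaOrbit (f : ℍ → ℂ) (hf : f ∈ thetaOrbit) (hd : MDiff f) :
    ModularForm (thetaStabilizer : Subgroup (GL (Fin 2) ℝ)) 2 where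
  toFun := f
  slash_action_eq' := by
    rintro _ ⟨γ, hγ, rfl⟩
    exact hγ f hf
  holo' := hd
  bdd_at_cusps' {c} hc := by
    rw [Subgroup.IsArithmetic.isCusp_iff_isCusp_SL2Z] at hc
    rw [OnePoint.isBoundedAt_iff_forall_SL2Z hc]
    exact fun γ _ ↦ isBoundedAtImInfty_of_mem_thetaOrbit (slash_mem_thetaOrbit γ f hf)

/-- The modular form `θ₂⁴` of weight two. -/
noncomputable def theta2PowFour : ModularForm (thetaStabilizer : Subgroup (GL (Fin 2) ℝ)) 2 :=
  modularFormOfMemThetaOrbit (fun τ ↦ theta2 τ ^ 4) (by simp [thetaOrbit])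
    mdifferentiable_theta2_pow_four

/-- The modular form `θ₃⁴` of weight two. -/
noncomputable def theta3PowFour : ModularForm (thetaStabilizer : Subgroup (GL (Fin 2) ℝ)) 2 :=
  modularFormOfMemThetaOrbit (fun τ ↦ theta3 τ ^ 4) (by simp [thetaOrbit])
    mdifferentiable_theta3_pow_four

end Modularity

/-- A modular form for `Γ`, regarded as a modular form for a smaller group. -/
def ModularForm.restrictSubgroup {Γ Γ' : Subgroup (GL (Fin 2) ℝ)} (h : Γ' ≤ Γ) {k : ℤ}
    (f : ModularForm Γ k) : ModularForm Γ' k where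
  toFun := f
  slash_action_eq' γ hγ := f.slash_action_eq' γ (h hγ)
  holo' := f.holo'
  bdd_at_cusps' hc := f.bdd_at_cusps' (hc.mono h)

/-! ### A Sturm bound for arithmetic groups -/

section Sturm

/-- A level one form that is `O(q ^ m)` at `i∞` has `q`-expansion of order at least `m`, by Cauchy's
estimate for the Taylor coefficients of the cusp function on small circles. -/
lemma ModularForm.le_order_qExpansion_of_isBigO {k : ℤ} (f : ModularForm 𝒮ℒ k) {m : ℕ}
    (hf : f =O[atImInfty] fun τ : ℍ ↦ Function.Periodic.qParam 1 τ ^ m) :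
    (m : ℕ∞) ≤ (qExpansion 1 f).order := by
  obtain ⟨C, hC0, hC⟩ := hf.exists_pos
  obtain ⟨A, -, hA⟩ := (atImInfty_basis.eventually_iff).mp hC.bound
  set δ : ℝ := min (1 / 2) (Real.exp (-2 * π * A)) with hδ
  have hδ0 : 0 < δ := by positivity
  have hbound {q : ℂ} (hq : q ≠ 0) (hqδ : ‖q‖ ≤ δ) : ‖cuspFunction 1 f q‖ ≤ C * ‖q‖ ^ m := by
    have hq1 : ‖q‖ < 1 := hqδ.trans_lt ((min_le_left _ _).trans_lt (by norm_num))
    let τ : ℍ := ⟨_, Function.Periodic.im_invQParam_pos_of_norm_lt_one one_pos hq1 hq⟩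
    have hqτ : Function.Periodic.qParam 1 (τ : ℂ) = q :=
      Function.Periodic.qParam_right_inv one_ne_zero hq
    have him : A ≤ τ.im := by
      have h1 : ‖q‖ = Real.exp (-2 * π * τ.im) := by
        rw [← hqτ, Function.Periodic.norm_qParam]; simp
      have h2 : ‖q‖ ≤ Real.exp (-2 * π * A) := hqδ.trans (min_le_right _ _)
      rw [h1, Real.exp_le_exp] at h2
      nlinarith [Real.pi_pos]
    have h := hA him
    rwa [← SlashInvariantFormClass.eq_cuspFunction f τ one_mem_strictPeriods_SL one_ne_zero, hqτ,
      norm_pow] at h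
  refine PowerSeries.nat_le_order _ _ fun n hn ↦ ?_
  rw [qExpansion_coeff, mul_eq_zero]
  refine .inr ?_
  have hest {R : ℝ} (hR : 0 < R) (hRδ : R ≤ δ) :
      ‖iteratedDeriv n (cuspFunction 1 f) 0‖ ≤ n.factorial * C * R ^ (m - n) := by
    have hR1 : R < 1 := hRδ.trans_lt ((min_le_left _ _).trans_lt (by norm_num))
    have hd : DiffContOnCl ℂ (cuspFunction 1 f) (Metric.ball 0 R) := by
      refine DifferentiableOn.diffContOnCl fun q hq ↦ ?_
      rw [closure_ball _ hR.ne', mem_closedBall_zero_iff] at hq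
      exact (ModularFormClass.differentiableAt_cuspFunction f one_pos one_mem_strictPeriods_SL
        (hq.trans_lt hR1)).differentiableWithinAt
    have h := Complex.norm_iteratedDeriv_le_of_forall_mem_sphere_norm_le n hR hd
      (C := C * R ^ m) fun q hq ↦ by
        rw [mem_sphere_zero_iff_norm] at hq
        rw [← hq]
        exact hbound (norm_pos_iff.mp (hq ▸ hR)) (hq ▸ hRδ)
    refine h.trans_eq ?_
    obtain ⟨j, rfl⟩ := Nat.exists_eq_add_of_le hn.le
    rw [Nat.add_sub_cancel_left, pow_add]
    field_simp
  have hlim : Tendsto (fun R : ℝ ↦ n.factorial * C * R ^ (m - n)) (nhdsWithin 0 (Set.Ioi 0))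
      (nhds 0) := by
    have : Continuous fun R : ℝ ↦ n.factorial * C * R ^ (m - n) := by fun_prop
    have h := this.tendsto 0
    rw [zero_pow (Nat.sub_ne_zero_of_lt hn), mul_zero] at h
    exact h.mono_left nhdsWithin_le_nhds
  have hle : ‖iteratedDeriv n (cuspFunction 1 f) 0‖ ≤ 0 := by
    refine ge_of_tendsto hlim ?_
    filter_upwards [Ioc_mem_nhdsGT hδ0] with R hR using hest hR.1 hR.2
  exact norm_le_zero_iff.mp hle

lemma qParam_one_eq_expPi_sq (τ : ℂ) : Function.Periodic.qParam 1 τ = expPi τ 1 ^ 2 := by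
  rw [Function.Periodic.qParam, expPi, ← Complex.exp_nat_mul]
  push_cast
  ring_nf

variable {Γ : Subgroup (GL (Fin 2) ℝ)} [Γ.IsArithmetic]

/-- A crude Sturm bound for an arithmetic group, from the one in level one applied to the norm. The
factor two is there because the level one parameter `q` is the square of `exp (π i τ)`. -/
lemma ModularForm.eq_zero_of_isBigO {w : ℕ} (f : ModularForm Γ w)
    (hf : f =O[atImInfty] fun τ : ℍ ↦
      expPi τ 1 ^ (2 * (w * Nat.card (𝒮ℒ ⧸ Γ.subgroupOf 𝒮ℒ) + 1))) : f = 0 := by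
  set d := Nat.card (𝒮ℒ ⧸ Γ.subgroupOf 𝒮ℒ) with hd
  have hN : (ModularForm.norm 𝒮ℒ f : ℍ → ℂ) =O[atImInfty] fun τ : ℍ ↦
      Function.Periodic.qParam 1 τ ^ (w * d + 1) := by
    classical
    let := Fintype.ofFinite (𝒮ℒ ⧸ Γ.subgroupOf 𝒮ℒ)
    have hb (q : 𝒮ℒ ⧸ Γ.subgroupOf 𝒮ℒ) :
        SlashInvariantForm.quotientFunc f q =O[atImInfty] fun _ ↦ (1 : ℂ) := by
      induction q using Quotient.inductionOn with
      | h r =>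
        obtain ⟨γ, hγ⟩ := r.2
        rw [SlashInvariantForm.quotientFunc_mk, ← hγ, ← map_inv]
        exact (ModularFormClass.bdd_at_infty_slash f γ⁻¹).trans
          (isBigO_const_const _ one_ne_zero _)
    -- Only the factor of the norm at the trivial coset is known to be small; the others are
    -- bounded.
    have h1 : SlashInvariantForm.quotientFunc f (⟦1⟧ : 𝒮ℒ ⧸ Γ.subgroupOf 𝒮ℒ) = f := by
      rw [SlashInvariantForm.quotientFunc_mk]
      simp
    obtain ⟨s, hs⟩ : ∃ s : Finset (𝒮ℒ ⧸ Γ.subgroupOf 𝒮ℒ), (f : ℍ → ℂ) *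
        ∏ q ∈ s, SlashInvariantForm.quotientFunc f q =
          ∏ q, SlashInvariantForm.quotientFunc f q := by
      have h := Finset.mul_prod_erase Finset.univ (SlashInvariantForm.quotientFunc f)
        (Finset.mem_univ (⟦1⟧ : 𝒮ℒ ⧸ Γ.subgroupOf 𝒮ℒ))
      rw [h1] at h
      exact ⟨_, h⟩
    refine IsBigO.congr_left ?_ (congrFun (hs.trans (ModularForm.coe_norm 𝒮ℒ f).symm))
    have h2 := hf.mul (IsBigO.finsetProd (s := s) fun q _ ↦ hb q)
    simp only [Finset.prod_const_one, mul_one, pow_mul, ← qParam_one_eq_expPi_sq] at h2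
    refine h2.congr_left fun τ ↦ ?_
    simp
  rw [← FunLike.coe_zero_iff, ← ModularForm.norm_eq_zero_iff 𝒮ℒ]
  refine ModularForm.sturm_bound_levelOne ?_
  refine lt_of_lt_of_le ?_ (le_order_qExpansion_of_isBigO _ hN)
  have : ((w : ℤ) * d).toNat = w * d := by exact_mod_cast Int.toNat_natCast (w * d)
  rw [this]
  exact_mod_cast Nat.lt_succ_of_le (Nat.div_le_self _ _)

/-- Sufficiently many modular forms with integral expansions satisfy a linear relation over `ℤ`:
there are more forms than linear conditions for vanishing to the order in the Sturm bound. -/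
lemma ModularForm.exists_int_relation {ι : Type*} [Fintype ι] {w : ℕ} (f : ι → ModularForm Γ w)
    (hf : ∀ i, HasIntExpansion (f i))
    (hι : 2 * (w * Nat.card (𝒮ℒ ⧸ Γ.subgroupOf 𝒮ℒ) + 1) < Fintype.card ι) :
    ∃ c : ι → ℤ, c ≠ 0 ∧ ∀ τ, ∑ i, (c i : ℂ) * f i τ = 0 := by
  classical
  set M := 2 * (w * Nat.card (𝒮ℒ ⧸ Γ.subgroupOf 𝒮ℒ) + 1) with hM
  choose Q hQ using fun i ↦ hf i M
  obtain ⟨c, hc0, hc, -⟩ := Int.Matrix.exists_ne_zero_int_vec_norm_le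
    (Matrix.of fun (t : Fin M) (i : ι) ↦ (Q i).coeff t) (by simpa using hι) (by simp [hM])
  refine ⟨c, hc0, ?_⟩
  set P : Polynomial ℤ := ∑ i, c i • Q i with hP
  have hdvd : Polynomial.X ^ M ∣ P := by
    rw [Polynomial.X_pow_dvd_iff]
    intro t ht
    have := congrFun hc ⟨t, ht⟩
    simpa [hP, Polynomial.finsetSum_coeff, Matrix.mulVec, dotProduct, mul_comm] using this
  have hPO : (fun τ : ℍ ↦ P.aeval (expPi τ 1)) =O[atImInfty] fun τ : ℍ ↦ expPi τ 1 ^ M := by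
    obtain ⟨R, hR⟩ := hdvd
    simpa [hR] using (isBigO_refl (fun τ : ℍ ↦ expPi τ 1 ^ M) atImInfty).mul
      (isBigO_aeval_expPi_one R)
  have hsum : (fun τ ↦ ∑ i, (c i : ℂ) * f i τ) =O[atImInfty] fun τ : ℍ ↦ expPi τ 1 ^ M := by
    have h := (IsBigO.fun_sum (s := Finset.univ)
      fun i _ ↦ (hQ i).const_mul_left (c i : ℂ)).add hPO
    refine h.congr_left fun τ ↦ ?_
    simp only [hP, map_sum, map_zsmul]
    simp only [zsmul_eq_mul, mul_sub, Finset.sum_sub_distrib, sub_add_cancel]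
  have hcoe : ((∑ i, c i • f i : ModularForm Γ w) : ℍ → ℂ) = fun τ ↦ ∑ i, (c i : ℂ) * f i τ := by
    funext τ
    simp
  have h0 := ModularForm.eq_zero_of_isBigO (∑ i, c i • f i) (by rw [hcoe]; exact hsum)
  rw [h0] at hcoe
  exact fun τ ↦ (congrFun hcoe τ).symm

end Sturm

/-! ### The relation between `λ(τ)` and `λ(pτ)` -/

section Scaling

/-- The matrix `diag(p, 1)`, acting on the upper half plane as `τ ↦ pτ`. -/
noncomputable def scaleMatrix (p : ℕ) [NeZero p] : GL (Fin 2) ℚ :=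
  Matrix.GeneralLinearGroup.mkOfDetNeZero !![(p : ℚ), 0; 0, 1] (by simp [NeZero.ne p])

variable (p : ℕ) [NeZero p]

lemma det_scaleMatrix_map : ((scaleMatrix p).map (Rat.castHom ℝ)).det.val = p := by
  rw [Matrix.GeneralLinearGroup.val_det_apply, Matrix.det_fin_two]
  simp [scaleMatrix, Matrix.GeneralLinearGroup.mkOfDetNeZero]

lemma det_scaleMatrix_map_pos : 0 < ((scaleMatrix p).map (Rat.castHom ℝ)).det.val := by
  rw [det_scaleMatrix_map]
  exact_mod_cast NeZero.pos p

lemma coe_scaleMatrix_smul (τ : ℍ) :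
    (((scaleMatrix p).map (Rat.castHom ℝ) • τ : ℍ) : ℂ) = p * τ := by
  rw [UpperHalfPlane.coe_smul_of_det_pos (det_scaleMatrix_map_pos p)]
  simp [num, denom, scaleMatrix, Matrix.GeneralLinearGroup.mkOfDetNeZero]

lemma slash_scaleMatrix_apply (f : ℍ → ℂ) (τ : ℍ) :
    (f ∣[(2 : ℤ)] (scaleMatrix p).map (Rat.castHom ℝ)) τ =
      p * f ((scaleMatrix p).map (Rat.castHom ℝ) • τ) := by
  have hdenom : denom ((scaleMatrix p).map (Rat.castHom ℝ)) τ = 1 := by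
    simp [denom, scaleMatrix, Matrix.GeneralLinearGroup.mkOfDetNeZero]
  rw [ModularForm.slash_apply, σ, if_pos (det_scaleMatrix_map_pos p), det_scaleMatrix_map, hdenom]
  simp [mul_comm]

end Scaling

open ConjAct Pointwise in
/-- A bihomogeneous relation between the fourth powers of `θ₂` and `θ₃` at `τ` and at `pτ`.
For large `n` there are more monomials of bidegree `(n, n)` than conditions for vanishing to the
order in the Sturm bound. -/
lemma exists_theta_relation (p : ℕ) [NeZero p] : ∃ n : ℕ, ∃ c : Fin (n + 1) × Fin (n + 1) → ℤ,
    c ≠ 0 ∧ ∀ τ : ℂ, 0 < τ.im → ∑ i, (c i : ℂ) *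
      ((theta2 τ ^ 4) ^ (i.1 : ℕ) * (theta3 τ ^ 4) ^ (n - i.1 : ℕ) *
        ((theta2 (p * τ) ^ 4) ^ (i.2 : ℕ) * (theta3 (p * τ) ^ 4) ^ (n - i.2 : ℕ))) = 0 := by
  set g : GL (Fin 2) ℝ := (scaleMatrix p).map (Rat.castHom ℝ) with hg
  have hgi : g⁻¹ = (scaleMatrix p)⁻¹.map (Rat.castHom ℝ) := by rw [hg, map_inv]
  set Γ₁ : Subgroup (GL (Fin 2) ℝ) := thetaStabilizer.map (Matrix.SpecialLinearGroup.mapGL ℝ)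
    with hΓ₁
  have : (toConjAct g⁻¹ • Γ₁).IsArithmetic := by
    rw [hgi]
    exact Subgroup.IsArithmetic.conj Γ₁ _
  set Γ : Subgroup (GL (Fin 2) ℝ) := Γ₁ ⊓ toConjAct g⁻¹ • Γ₁ with hΓ
  set d := Nat.card (𝒮ℒ ⧸ Γ.subgroupOf 𝒮ℒ) with hd
  let A : ModularForm Γ 2 := theta2PowFour.restrictSubgroup inf_le_left
  let B : ModularForm Γ 2 := theta3PowFour.restrictSubgroup inf_le_left
  let A' : ModularForm Γ 2 := (ModularForm.translate theta2PowFour g).restrictSubgroup inf_le_right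
  let B' : ModularForm Γ 2 := (ModularForm.translate theta3PowFour g).restrictSubgroup inf_le_right
  have hA (τ : ℍ) : A τ = theta2 τ ^ 4 := rfl
  have hB (τ : ℍ) : B τ = theta3 τ ^ 4 := rfl
  -- The weight two slash action of `diag(p, 1)` is `f ↦ p f(pτ)`; the factor `p` keeps the
  -- expansions integral and is cancelled at the end.
  have hA' (τ : ℍ) : A' τ = p * theta2 (p * τ) ^ 4 := by
    rw [← coe_scaleMatrix_smul]
    exact slash_scaleMatrix_apply p theta2PowFour τ
  have hB' (τ : ℍ) : B' τ = p * theta3 (p * τ) ^ 4 := by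
    rw [← coe_scaleMatrix_smul]
    exact slash_scaleMatrix_apply p theta3PowFour τ
  have eA : HasIntExpansion A := hasIntExpansion_theta2_pow_four
  have eB : HasIntExpansion B := hasIntExpansion_theta3_pow_four
  have eC : HasIntExpansion fun _ ↦ (p : ℂ) := by
    simpa using HasIntExpansion.aeval (p : Polynomial ℤ)
  have eA' : HasIntExpansion A' := by
    convert! eC.mul (hasIntExpansion_theta2_pow_four.comp_natCast_mul (NeZero.pos p)
      (coe_scaleMatrix_smul p)) using 1
    funext τ
    rw [hA', Pi.mul_apply, coe_scaleMatrix_smul]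
  have eB' : HasIntExpansion B' := by
    convert! eC.mul (hasIntExpansion_theta3_pow_four.comp_natCast_mul (NeZero.pos p)
      (coe_scaleMatrix_smul p)) using 1
    funext τ
    rw [hB', Pi.mul_apply, coe_scaleMatrix_smul]
  -- Large enough for `(n + 1) ^ 2 > 2 * (4 * n * d + 1)`.
  set n := 8 * (d + 1) with hn
  let F (i : Fin (n + 1) × Fin (n + 1)) : ModularForm Γ (4 * n : ℕ) :=
    ModularForm.mcast (by have := i.1.is_le; have := i.2.is_le; push_cast; omega)
      (((A.pow i.1).mul (B.pow (n - i.1))).mul ((A'.pow i.2).mul (B'.pow (n - i.2))))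
  have hF (i) : (F i : ℍ → ℂ) = A ^ (i.1 : ℕ) * B ^ (n - i.1 : ℕ) *
      (A' ^ (i.2 : ℕ) * B' ^ (n - i.2 : ℕ)) := by
    simp [F]
  obtain ⟨c, hc0, hc⟩ := ModularForm.exists_int_relation F (fun i ↦ by
    rw [hF]
    exact ((eA.pow _).mul (eB.pow _)).mul ((eA'.pow _).mul (eB'.pow _))) (by
    rw [Fintype.card_prod, Fintype.card_fin, ← hd, hn]
    nlinarith)
  refine ⟨n, c, hc0, fun τ hτ ↦ ?_⟩
  have hp : (p : ℂ) ≠ 0 := NeZero.ne _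
  refine (mul_eq_zero_iff_left (pow_ne_zero n hp)).mp ?_
  rw [← hc ⟨τ, hτ⟩, Finset.mul_sum]
  refine Finset.sum_congr rfl fun i _ ↦ ?_
  rw [hF]
  simp only [Pi.mul_apply, Pi.pow_apply, hA, hB, hA', hB', mul_pow]
  have : (p : ℂ) ^ n = p ^ (i.2 : ℕ) * p ^ (n - i.2 : ℕ) := by
    rw [← pow_add, Nat.add_sub_of_le i.2.is_le]
  rw [this]
  ring

lemma legendreLambda_eq (τ : ℂ) : legendreLambda τ = theta2 τ ^ 4 / theta3 τ ^ 4 := rfl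

lemma exists_modular_relation (p : ℕ) (hp : 0 < p) : ∃ P : MvPolynomial (Fin 2) ℤ, P ≠ 0 ∧
    ∀ τ : ℂ, 0 < τ.im →
      MvPolynomial.aeval ![legendreLambda τ, legendreLambda ((p : ℂ) * τ)] P = 0 := by
  have : NeZero p := ⟨hp.ne'⟩
  obtain ⟨n, c, hc0, hc⟩ := exists_theta_relation p
  let e (i : Fin (n + 1) × Fin (n + 1)) : Fin 2 →₀ ℕ := Finsupp.equivFunOnFinite.symm ![i.1, i.2]
  have he : Function.Injective e := fun i j h ↦ by
    have h := Finsupp.equivFunOnFinite.symm.injective h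
    ext
    · simpa using congrFun h 0
    · simpa using congrFun h 1
  refine ⟨∑ i, MvPolynomial.monomial (e i) (c i), fun h ↦ hc0 ?_, fun τ hτ ↦ ?_⟩
  · funext j
    have := congrArg (MvPolynomial.coeff (e j)) h
    simpa [MvPolynomial.coeff_sum, MvPolynomial.coeff_monomial, he.eq_iff] using this
  · have hpτ : 0 < (p * τ).im := by
      simpa using mul_pos (Nat.cast_pos.mpr hp) hτ
    have h3 := theta3_ne_zero hτ
    have h3' := theta3_ne_zero hpτ
    have key : (theta3 τ ^ 4) ^ n * (theta3 (p * τ) ^ 4) ^ n ≠ 0 := by positivity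
    refine (mul_eq_zero_iff_left key).mp ?_
    rw [← hc τ hτ, map_sum, Finset.mul_sum]
    refine Finset.sum_congr rfl fun i _ ↦ ?_
    have d1 : (theta3 τ ^ 4) ^ n = (theta3 τ ^ 4) ^ (i.1 : ℕ) * (theta3 τ ^ 4) ^ (n - i.1 : ℕ) := by
      rw [← pow_add, Nat.add_sub_of_le i.1.is_le]
    have d2 : (theta3 (p * τ) ^ 4) ^ n =
        (theta3 (p * τ) ^ 4) ^ (i.2 : ℕ) * (theta3 (p * τ) ^ 4) ^ (n - i.2 : ℕ) := by
      rw [← pow_add, Nat.add_sub_of_le i.2.is_le]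
    rw [MvPolynomial.aeval_monomial, Finsupp.prod_fintype _ _ (by simp), d1, d2]
    simp [e, legendreLambda_eq, div_pow]
    field_simp

/-! ### The modular equations -/

theorem theorem3p1 :
    -- the denominator of the Legendre modular function has no zero
    (∀ τ : ℂ, 0 < τ.im → thetaChar 0 0 0 τ ≠ 0) ∧
    -- a non-trivial polynomial relation, with integer coefficients, for every prime
    (∀ p : ℕ, p.Prime →
      ∃ P : MvPolynomial (Fin 2) ℤ, P ≠ 0 ∧
        ∀ τ : ℂ, 0 < τ.im →
          MvPolynomial.aeval ![legendreLambda τ, legendreLambda ((p : ℂ) * τ)] P = 0) ∧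
    -- the example for the prime three, with its fourth roots
    (∀ τ : ℂ, 0 < τ.im →
      fourthRootLambda τ ^ 4 = legendreLambda τ ∧
      fourthRootOneSubLambda τ ^ 4 = 1 - legendreLambda τ ∧
      1 = fourthRootLambda τ * fourthRootLambda (3 * τ) +
        fourthRootOneSubLambda τ * fourthRootOneSubLambda (3 * τ)) := by
  refine ⟨fun τ hτ ↦ theta3_ne_zero hτ, fun p hp ↦ exists_modular_relation p hp.pos,
    fun τ hτ ↦ ⟨div_pow .., ?_, ?_⟩⟩
  · have h := theta3_ne_zero hτ
    change (theta4 τ / theta3 τ) ^ 4 = 1 - theta2 τ ^ 4 / theta3 τ ^ 4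
    field_simp
    linear_combination -theta3_pow_four hτ
  · have h := theta3_ne_zero hτ
    have h' := theta3_ne_zero (three_mul_im_pos hτ)
    change 1 = theta2 τ / theta3 τ * (theta2 (3 * τ) / theta3 (3 * τ)) +
      theta4 τ / theta3 τ * (theta4 (3 * τ) / theta3 (3 * τ))
    field_simp
    linear_combination theta3_mul_theta3_three_mul hτ
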